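/- **Theorem (streaming lower bound for Matrix Product).** *The problem.* Let $n,c_1,c_2\ge 1$ be integers, $c=c_1+c_2$, $\varepsilon\in(0,1)$ and $\gamma>0$. Integer matrices $A\in\mathbb{Z}^{n\times c_1}$ and $B\in\mathbb{Z}^{n\times c_2}$ are initially zero and are presented as an arbitrary finite stream of additive updates, each of the form $A_{ij}\leftarrow A_{ij}+\delta$ or $B_{ij}\leftarrow B_{ij}+\delta$ with $\delta\in\mathbb{Z}$ (possibly negative), in any order and with any number of updates per entry, such that at all times all entries of $A$ and $B$ are $O(\log(nc))$-bit integers, that is, have absolute value at most $(nc)^{\gamma}$. After the stream the algorithm has to output a real $c_1\times c_2$ matrix $C$ with $$\|A^{T}B-C\|_F\le\varepsilon\,\|A\|_F\,\|B\|_F .$$ *The algorithms.* A randomized one-pass algorithm with $S$ bits of space has a memory in $\{0,1\}^S$. The initial memory is a function of the random coins; each update is read once, in order, and the new memory is a function of the coins, the number of updates read so far, the old memory and the update; the output is a function of the coins and of the final memory. Only the memory is charged (access to the coins and to the time is free). The algorithm solves the problem with probability at least $4/5$ if, for every stream as above, the output is correct with probability at least $4/5$ over the coins. *The bound.* There is an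 absolute constant $\beta>0$ such that for every $\gamma>0$ and every $\varepsilon_0<1$ there is a constant $\kappa>0$, depending only on $\gamma$ and $\varepsilon_0$, with the following property. For all integers $n,c_1,c_2\ge1$, with $c=c_1+c_2$, and all $0<\varepsilon\le\varepsilon_0$ with $$n\ \ge\ \frac{\beta\,\log_{10}(cn)}{\varepsilon^{2}},$$ every randomized one-pass algorithm that solves the above Matrix Product problem with probability at least $4/5$ uses at least $\kappa\, c\,\varepsilon^{-2}\log(nc)$ bits of space; that is, it uses $\Omega(c\,\varepsilon^{-2}\log(nc))$ bits. -/

import Mathlib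

open MeasureTheory

attribute [local instance] Matrix.frobeniusNormedAddCommGroup

namespace MatrixProductStream

/-- An additive update to one entry of a pair of matrices `(A, B)` with `n` rows each, where `A`
has `c₁` columns and `B` has `c₂` columns: `left i j δ` means `A i j ← A i j + δ`, and
`right i j δ` means `B i j ← B i j + δ`. -/
inductive Update (n c₁ c₂ : ℕ) : Type
  | left (i : Fin n) (j : Fin c₁) (δ : ℤ)
  | right (i : Fin n) (j : Fin c₂) (δ : ℤ)

variable {n c₁ c₂ S : ℕ}

/-- The effect of an update on the pair `(A, B)`. -/
def Update.apply :
    Matrix (Fin n) (Fin c₁) ℤ × Matrix (Fin n) (Fin c₂) ℤ → Update n c₁ c₂ →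
      Matrix (Fin n) (Fin c₁) ℤ × Matrix (Fin n) (Fin c₂) ℤ
  | (A, B), .left i j δ => (A + Matrix.single i j δ, B)
  | (A, B), .right i j δ => (A, B + Matrix.single i j δ)

/-- The pair `(A, B)` after the stream `u` of updates; both matrices are initially zero. -/
def matrices (u : List (Update n c₁ c₂)) :
    Matrix (Fin n) (Fin c₁) ℤ × Matrix (Fin n) (Fin c₂) ℤ :=
  u.foldl Update.apply (0, 0)

/-- At all times in the stream `u` the entries of both matrices are at most `M` in absolute
value. -/
def BoundedBy (M : ℝ) (u : List (Update n c₁ c₂)) : Prop :=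
  ∀ v : List (Update n c₁ c₂), v <+: u →
    (∀ i j, |(((matrices v).1 i j : ℤ) : ℝ)| ≤ M) ∧ (∀ i j, |(((matrices v).2 i j : ℤ) : ℝ)| ≤ M)

/-- `C` approximates `Aᵀ * B` to within `ε` times the product of the Frobenius norms. The norms
are Mathlib's Frobenius norms. -/
def IsApproxProduct (ε : ℝ) (A : Matrix (Fin n) (Fin c₁) ℝ) (B : Matrix (Fin n) (Fin c₂) ℝ)
    (C : Matrix (Fin c₁) (Fin c₂) ℝ) : Prop :=
  ‖A.transpose * B - C‖ ≤ ε * ‖A‖ * ‖B‖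

/-- A randomized one-pass streaming algorithm with `S` bits of memory, whose coins are drawn from
`Ω`. The input is accessed only through the updates, each read once and in order. Only the
memory carried from one update to the next is charged: the coins, the number of updates read so
far and the work done inside one step are free. As `step` sees the coins and the time, it may use
fresh coins for each update, or reuse earlier ones at will. -/
structure Algorithm (Ω : Type*) [MeasurableSpace Ω] (n c₁ c₂ S : ℕ) where
  /-- the initial memory -/
  init : Ω → (Fin S → Bool)
  /-- the new memory, from the coins, the time, the old memory and the update being read -/
  step : Ω → ℕ → (Fin S → Bool) → Update n c₁ c₂ → (Fin S → Bool)
  /-- the output, from the coins and the final memory -/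
  output : Ω → (Fin S → Bool) → Matrix (Fin c₁) (Fin c₂) ℝ
  measurable_init : Measurable init
  measurable_step : ∀ t s x, Measurable fun ω => step ω t s x
  measurable_output : ∀ s i j, Measurable fun ω => output ω s i j

variable {Ω : Type*} [MeasurableSpace Ω]

/-- The memory after the stream `u`; the update read at time `t` is the `t`-th one, from `0`. -/
def Algorithm.memory (alg : Algorithm Ω n c₁ c₂ S) (ω : Ω) (u : List (Update n c₁ c₂)) :
    Fin S → Bool :=
  u.zipIdx.foldl (fun s x => alg.step ω x.2 s x.1) (alg.init ω)

/-- The output on the stream `u`. -/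
def Algorithm.run (alg : Algorithm Ω n c₁ c₂ S) (ω : Ω) (u : List (Update n c₁ c₂)) :
    Matrix (Fin c₁) (Fin c₂) ℝ :=
  alg.output ω (alg.memory ω u)

/-- The algorithm solves Matrix Product with accuracy `ε` and probability at least `p` on every
stream along which the entries are integers of absolute value at most `M`. -/
def Algorithm.Solves (alg : Algorithm Ω n c₁ c₂ S) (P : Measure Ω) (ε M p : ℝ) : Prop :=
  ∀ u : List (Update n c₁ c₂), BoundedBy M u →
    p ≤ P.real {ω | IsApproxProduct ε ((matrices u).1.map (fun z : ℤ => (z : ℝ)))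
      ((matrices u).2.map (fun z : ℤ => (z : ℝ))) (alg.run ω u)}

end MatrixProductStream

/-! The proof is a reduction from augmented indexing. Let `m` be the larger of the two column
counts, say that of the left matrix. Write into it `N = r * T` rows of arbitrary signs, row `i`
scaled by `K ^ (i / r)`, with `r` of order `1 / ε ^ 2` and `T` of order `log (n c)`. To recover row
`t`, a decoder that knows the later rows resumes from the stored memory, deletes those rows and puts
a single `1` into the right matrix, so that one column of the product is row `t`. The remaining rows
grow geometrically, so their norm is governed by the scale of row `t`, and the permitted error
leaves a squared distance of at most `(1 - ρ) m` to the sign vector (`mul_sum_sq_signMatrix_le`,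
`mem_decode`).

A ball of this radius contains at most a fraction `exp (-b)` of the sign vectors, `b = max (log 2)
(ρ m / 2)` (`card_signBall_le`). The memory thus yields a short list containing row `t`, correct for
an average fraction `4/5` of the pairs `(x, t)` once good coins are fixed
(`exists_mul_card_le_card_filter`).

For each fixed memory the number of correct lists is dominated by a binomial variable. Summing its
exponential moment over all memories and comparing with the average success
(`mul_le_five_mul_log_card`) gives `N * b ≤ 5 * S * log 2`, which has the claimed order. -/

namespace MatrixProductStream

/-! ### Augmented indexing with list decoding -/

section Counting

variable {X : Type*} [Fintype X] [DecidableEq X] [Nonempty X]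

/-- If `L t x` depends only on the coordinates of `x` after `t` and contains at most a fraction `q`
of all symbols, then the number of `t` with `x t ∈ L t x`, for uniform `x`, has its moment
generating function bounded by that of a binomial variable with parameter `q`. -/
theorem sum_prod_ite_mem_le {q l : ℝ} (hl : 1 ≤ l) :
    ∀ (N : ℕ) (L : Fin N → (Fin N → X) → Finset X),
      (∀ t x y, (∀ u, t < u → x u = y u) → L t x = L t y) →
      (∀ t x, ((L t x).card : ℝ) ≤ q * Fintype.card X) →
      ∑ x, ∏ t, (if x t ∈ L t x then l else 1) ≤
        ((Fintype.card X : ℝ) * (1 + (l - 1) * q)) ^ N := by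
  intro N
  induction N with
  | zero => intro L _ _; simp
  | succ N ih =>
    intro L hdep hcard
    obtain ⟨a₀⟩ := ‹Nonempty X›
    -- No list sees coordinate `0`, so that symbol can be summed out first and replaced by `a₀` in
    -- every list.
    have h0 : ∀ a (y : Fin N → X), L 0 (Fin.cons a y) = L 0 (Fin.cons a₀ y : Fin (N + 1) → X) := by
      intro a y
      refine hdep _ _ _ fun u hu => ?_
      obtain ⟨v, rfl⟩ := Fin.exists_succ_eq.2 hu.ne'
      simp
    have hs : ∀ (t : Fin N) a (y : Fin N → X),
        L t.succ (Fin.cons a y) = L t.succ (Fin.cons a₀ y : Fin (N + 1) → X) := by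
      intro t a y
      refine hdep _ _ _ fun u hu => ?_
      obtain ⟨v, rfl⟩ := Fin.exists_succ_eq.2 ((Fin.succ_pos t).trans hu).ne'
      simp
    have hsum : ∀ y : Fin N → X,
        ∑ a, (if a ∈ L 0 (Fin.cons a₀ y : Fin (N + 1) → X) then l else 1) ≤
          (Fintype.card X : ℝ) * (1 + (l - 1) * q) := by
      intro y
      set F := L 0 (Fin.cons a₀ y : Fin (N + 1) → X) with hF
      have h1 : ∑ a, (if a ∈ F then l else 1) = (Fintype.card X : ℝ) + (l - 1) * F.card := by
        have : ∀ a, (if a ∈ F then l else 1) = 1 + (if a ∈ F then (l - 1) else 0) := by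
          intro a; split_ifs <;> ring
        simp only [this, Finset.sum_add_distrib, Finset.sum_ite_mem, Finset.univ_inter]
        simp only [Finset.sum_const, Finset.card_univ, nsmul_eq_mul, mul_one, mul_comm]
      rw [h1]
      nlinarith [hcard 0 (Fin.cons a₀ y : Fin (N + 1) → X)]
    have hsplit : ∑ x : Fin (N + 1) → X, ∏ t, (if x t ∈ L t x then l else 1) =
        ∑ y : Fin N → X, (∑ a, (if a ∈ L 0 (Fin.cons a₀ y : Fin (N + 1) → X) then l else 1)) *
          ∏ t, (if y t ∈ L t.succ (Fin.cons a₀ y : Fin (N + 1) → X) then l else 1) := by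
      rw [← (Fin.consEquiv (fun _ : Fin (N + 1) => X)).sum_comp, Fintype.sum_prod_type,
        Finset.sum_comm]
      refine Finset.sum_congr rfl fun y _ => ?_
      rw [Finset.sum_mul]
      refine Finset.sum_congr rfl fun a _ => ?_
      simp only [Fin.consEquiv, Equiv.coe_fn_mk]
      rw [Fin.prod_univ_succ]
      simp only [Fin.cons_zero, Fin.cons_succ, h0 a y, hs _ a y]
    have hpos : 0 ≤ (Fintype.card X : ℝ) * (1 + (l - 1) * q) :=
      le_trans (Finset.sum_nonneg fun a _ => by split_ifs <;> linarith) (hsum fun _ => a₀)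
    rw [hsplit, pow_succ']
    calc _ ≤ ∑ y : Fin N → X, ((Fintype.card X : ℝ) * (1 + (l - 1) * q)) *
          ∏ t, (if y t ∈ L t.succ (Fin.cons a₀ y : Fin (N + 1) → X) then l else 1) := by
          refine Finset.sum_le_sum fun y _ => mul_le_mul_of_nonneg_right (hsum y) ?_
          exact Finset.prod_nonneg fun t _ => by split_ifs <;> linarith
      _ ≤ _ := by
          rw [← Finset.mul_sum]
          refine mul_le_mul_of_nonneg_left (ih _ ?_ fun t y => hcard _ _) hpos
          intro t x y hxy
          refine hdep _ _ _ fun u hu => ?_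
          obtain ⟨v, rfl⟩ := Fin.exists_succ_eq.2 ((Fin.succ_pos t).trans hu).ne'
          simpa using hxy v (Fin.succ_lt_succ_iff.1 hu)

/-- Leaves a gain of `b / 5` per symbol: `4 b / 5` from the success rate, less at most `3 b / 5`
from the binomial moment. It fails for `b` near `0`, hence the threshold `log 2`. -/
theorem five_mul_log_two_sub_exp_neg_le {b : ℝ} (hb : Real.log 2 ≤ b) :
    5 * Real.log (2 - Real.exp (-b)) ≤ 3 * b := by
  set q := Real.exp (-b) with hq
  have hq0 : 0 < q := Real.exp_pos _
  have hq2 : q ≤ 1 / 2 := by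
    rw [hq, Real.exp_neg, one_div]
    exact inv_anti₀ two_pos ((Real.log_le_iff_le_exp two_pos).1 hb)
  have hb' : b = -Real.log q := by rw [hq, Real.log_exp]; ring
  have hpos : 0 < 2 - q := by linarith
  have hle : (2 - q) ^ 5 * q ^ 3 ≤ 1 := by
    have h1 : (2 - q) * q ≤ 3 / 4 := by nlinarith
    have h2 : 0 ≤ (2 - q) * q := by positivity
    have h3 : (2 - q) * ((2 - q) * q) ≤ 9 / 8 := by
      nlinarith [mul_nonneg hq0.le (sub_nonneg.2 hq2)]
    have h4 : 0 ≤ (2 - q) * ((2 - q) * q) := by positivity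
    have h5 : (2 - q) ^ 5 * q ^ 3 =
        ((2 - q) * ((2 - q) * q)) * ((2 - q) * ((2 - q) * q)) * ((2 - q) * q) := by ring
    rw [h5]
    calc _ ≤ (9 / 8 : ℝ) * (9 / 8) * (3 / 4) := by gcongr
      _ ≤ 1 := by norm_num
  have := Real.log_le_log (by positivity) hle
  rw [Real.log_mul (by positivity) (by positivity), Real.log_pow, Real.log_pow, Real.log_one]
    at this
  push_cast at this
  rw [hb']; linarith

/-- Lower bound for augmented indexing with list decoding: if the message `enc x` and the symbols
after `t` determine a short list that contains `x t` for an average fraction `4 / 5` of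
the pairs `(x, t)`, then there are many messages. -/
theorem mul_le_five_mul_log_card {St : Type*} [Fintype St] {N : ℕ} (enc : (Fin N → X) → St)
    (L : St → Fin N → (Fin N → X) → Finset X)
    (hdep : ∀ s t x y, (∀ u, t < u → x u = y u) → L s t x = L s t y) {b : ℝ}
    (hb : Real.log 2 ≤ b)
    (hcard : ∀ s t x, ((L s t x).card : ℝ) ≤ Real.exp (-b) * Fintype.card X)
    (havg : 4 / 5 * ((Fintype.card X : ℝ) ^ N * N) ≤
      ∑ x, ((Finset.univ.filter fun t => x t ∈ L (enc x) t x).card : ℝ)) :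
    N * b ≤ 5 * Real.log (Fintype.card St) := by
  set Q : ℝ := (Fintype.card X : ℝ) with hQ
  have hQ0 : 0 < Q := by rw [hQ]; exact_mod_cast Fintype.card_pos
  have hb0 : 0 < b := (Real.log_pos one_lt_two).trans_le hb
  -- The weight is the reciprocal of the list density, so the moment per symbol is below `2`.
  set l := Real.exp b with hl
  have hl1 : 1 ≤ l := Real.one_le_exp hb0.le
  have hlq : 1 + (l - 1) * Real.exp (-b) = 2 - Real.exp (-b) := by
    have : l * Real.exp (-b) = 1 := by rw [hl, ← Real.exp_add]; simp
    linarith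
  have hq1 : Real.exp (-b) < 1 := by
    rw [← Real.exp_zero]; exact Real.exp_lt_exp.2 (by linarith)
  let g : (Fin N → X) → ℝ := fun x => ((Finset.univ.filter fun t => x t ∈ L (enc x) t x).card : ℝ)
  have hprod : ∀ s (x : Fin N → X), ∏ t, (if x t ∈ L s t x then l else 1) =
      Real.exp (b * ((Finset.univ.filter fun t => x t ∈ L s t x).card : ℝ)) := by
    intro s x
    rw [Finset.prod_ite, Finset.prod_const, Finset.prod_const_one, mul_one, hl, ← Real.exp_nat_mul,
      mul_comm]
  have hup : ∑ x, Real.exp (b * g x) ≤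
      (Fintype.card St : ℝ) * (Q * (2 - Real.exp (-b))) ^ N := by
    calc ∑ x, Real.exp (b * g x)
        ≤ ∑ x, ∑ s, ∏ t, (if x t ∈ L s t x then l else 1) := by
          refine Finset.sum_le_sum fun x _ => ?_
          rw [← hprod (enc x) x]
          exact Finset.single_le_sum (f := fun s => ∏ t, (if x t ∈ L s t x then l else 1))
            (fun s _ => Finset.prod_nonneg fun t _ => by split_ifs <;> linarith)
            (Finset.mem_univ _)
      _ = ∑ s, ∑ x, ∏ t, (if x t ∈ L s t x then l else 1) := Finset.sum_comm
      _ ≤ ∑ _s : St, (Q * (2 - Real.exp (-b))) ^ N := by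
          refine Finset.sum_le_sum fun s _ => ?_
          rw [← hlq]
          exact sum_prod_ite_mem_le hl1 N (L s) (hdep s) (hcard s)
      _ = _ := by simp
  have hlow : Q ^ N * Real.exp (b * (4 / 5 * N)) ≤ ∑ x, Real.exp (b * g x) := by
    set a := b * (4 / 5 * (N : ℝ)) with ha
    have hc : ((Finset.univ : Finset (Fin N → X)).card : ℝ) = Q ^ N := by
      simp [hQ]
    -- Jensen's inequality, through the tangent to `exp` at `a`.
    calc Q ^ N * Real.exp a ≤ ∑ x, Real.exp a * (b * g x - a + 1) := by
          rw [← Finset.mul_sum, Finset.sum_add_distrib, Finset.sum_sub_distrib, ← Finset.mul_sum,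
            Finset.sum_const, Finset.sum_const, nsmul_eq_mul, nsmul_eq_mul, hc, mul_comm]
          refine mul_le_mul_of_nonneg_left ?_ (Real.exp_pos a).le
          have := mul_le_mul_of_nonneg_left havg hb0.le
          change b * (4 / 5 * (Q ^ N * N)) ≤ b * ∑ x, g x at this
          rw [ha]; linarith
      _ ≤ ∑ x, Real.exp (b * g x) := by
          refine Finset.sum_le_sum fun x _ => ?_
          calc _ ≤ Real.exp a * Real.exp (b * g x - a) :=
                mul_le_mul_of_nonneg_left (Real.add_one_le_exp _) (Real.exp_pos a).le
            _ = _ := by rw [← Real.exp_add]; ring_nf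
  have hmain : Real.exp (b * (4 / 5 * N)) ≤
      (Fintype.card St : ℝ) * (2 - Real.exp (-b)) ^ N := by
    have := hlow.trans hup
    rw [mul_pow, mul_left_comm (Fintype.card St : ℝ)] at this
    exact le_of_mul_le_mul_left this (by positivity)
  have hSt : 0 < (Fintype.card St : ℝ) := by
    by_contra h
    have h0 : (Fintype.card St : ℝ) = 0 := le_antisymm (not_lt.1 h) (Nat.cast_nonneg _)
    rw [h0, zero_mul] at hmain
    exact absurd (Real.exp_pos _) (not_lt.2 hmain)
  have h2q : 0 < 2 - Real.exp (-b) := by linarith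
  have hlog := Real.log_le_log (Real.exp_pos _) hmain
  rw [Real.log_exp, Real.log_mul hSt.ne' (by positivity), Real.log_pow] at hlog
  have h5 := mul_le_mul_of_nonneg_left (five_mul_log_two_sub_exp_neg_le hb) (Nat.cast_nonneg (α := ℝ) N)
  linarith

end Counting

/-! ### Fixing the coins -/

/-- Averaging: if finitely many events have probability at least `p`, some outcome lies in at least
a fraction `p` of them. -/
theorem exists_mul_card_le_card_filter {Ω ι : Type*} [MeasurableSpace Ω] [Fintype ι]
    (P : Measure Ω) [IsProbabilityMeasure P] {p : ℝ} (E : ι → Set Ω)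
    (hE : ∀ i, MeasurableSet (E i)) (hp : ∀ i, p ≤ P.real (E i)) :
    ∃ ω, p * Fintype.card ι ≤ ∑ i, (E i).indicator (fun _ => (1 : ℝ)) ω := by
  have hint : ∀ i, Integrable ((E i).indicator fun _ => (1 : ℝ)) P := fun i =>
    (integrable_const _).indicator (hE i)
  obtain ⟨ω, hω⟩ := exists_integral_le (μ := P)
    (f := fun ω => ∑ i, (E i).indicator (fun _ => (1 : ℝ)) ω) (integrable_finsetSum _ fun i _ => hint i)
  refine ⟨ω, le_trans ?_ hω⟩
  rw [integral_finsetSum _ fun i _ => hint i]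
  have : ∀ i, ∫ ω, (E i).indicator (fun _ => (1 : ℝ)) ω ∂P = P.real (E i) := fun i => by
    rw [integral_indicator_const _ (hE i)]; simp
  simp only [this]
  calc p * Fintype.card ι = ∑ _i : ι, p := by simp [mul_comm]
    _ ≤ _ := Finset.sum_le_sum fun i _ => hp i

/-! ### Sign vectors near a given point -/

/-- The sign `1` or `-1` coded by a bit. -/
def sign (a : Bool) : ℤ := if a then 1 else -1

theorem abs_sign (a : Bool) : |sign a| = 1 := by cases a <;> simp [sign]

theorem sign_not (a : Bool) : sign (!a) = -sign a := by cases a <;> simp [sign]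

theorem sign_sq (a : Bool) : ((sign a : ℤ) : ℝ) ^ 2 = 1 := by cases a <;> simp [sign]

/-- The sign vectors whose squared distance to `C` is at most `(1 - ρ) m`. -/
noncomputable def signBall {m : ℕ} (ρ : ℝ) (C : Fin m → ℝ) : Finset (Fin m → Bool) :=
  Finset.univ.filter fun v => ∑ j, ((sign (v j) : ℝ) - C j) ^ 2 ≤ (1 - ρ) * m

theorem le_inner_of_mem_signBall {m : ℕ} {ρ : ℝ} {C : Fin m → ℝ} {v : Fin m → Bool}
    (hv : v ∈ signBall ρ C) : ρ * m / 2 ≤ ∑ j, ((sign (v j) : ℝ) * C j - C j ^ 2 / 2) := by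
  have h := (Finset.mem_filter.1 hv).2
  have : ∑ j, ((sign (v j) : ℝ) - C j) ^ 2 =
      m - 2 * ∑ j, ((sign (v j) : ℝ) * C j - C j ^ 2 / 2) := by
    rw [Finset.mul_sum, eq_sub_iff_add_eq, ← Finset.sum_add_distrib]
    rw [Finset.sum_congr rfl (g := fun _ => (1 : ℝ)) fun j _ => by
      have := sign_sq (v j); linear_combination this]
    simp
  linarith

/-- A Chernoff bound: the exponential of the inner expression factors over coordinates, and each
factor averages to `cosh (C j) * exp (-C j ^ 2 / 2) ≤ 1`. -/
theorem card_signBall_le_exp {m : ℕ} (ρ : ℝ) (C : Fin m → ℝ) :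
    ((signBall ρ C).card : ℝ) ≤ Real.exp (-(ρ * m / 2)) * 2 ^ m := by
  have hsum : ∑ v : Fin m → Bool, Real.exp (∑ j, ((sign (v j) : ℝ) * C j - C j ^ 2 / 2)) ≤ 2 ^ m := by
    have h1 : ∑ v : Fin m → Bool, Real.exp (∑ j, ((sign (v j) : ℝ) * C j - C j ^ 2 / 2)) =
        ∏ j, ∑ a : Bool, Real.exp ((sign a : ℝ) * C j - C j ^ 2 / 2) := by
      rw [Finset.prod_univ_sum, Fintype.piFinset_univ]
      simp only [Real.exp_sum]
    rw [h1]
    calc _ ≤ ∏ _j : Fin m, (2 : ℝ) := by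
          refine Finset.prod_le_prod (fun j _ => by positivity) fun j _ => ?_
          have h2 := Real.cosh_le_exp_half_sq (C j)
          rw [Real.cosh_eq] at h2
          have h3 : Real.exp (C j ^ 2 / 2) * Real.exp (-(C j ^ 2 / 2)) = 1 := by
            rw [← Real.exp_add]; simp
          simp only [Fintype.sum_bool, sign, if_true, Bool.false_eq_true, if_false, sub_eq_add_neg,
            Real.exp_add]
          push_cast
          rw [one_mul, neg_one_mul]
          nlinarith [Real.exp_pos (-(C j ^ 2 / 2))]
      _ = 2 ^ m := by simp
  have : ((signBall ρ C).card : ℝ) * Real.exp (ρ * m / 2) ≤ 2 ^ m := by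
    refine le_trans ?_ hsum
    rw [← nsmul_eq_mul, ← Finset.sum_const]
    refine (Finset.sum_le_sum fun v hv => Real.exp_le_exp.2 (le_inner_of_mem_signBall hv)).trans ?_
    exact Finset.sum_le_univ_sum_of_nonneg fun _ => (Real.exp_pos _).le
  calc ((signBall ρ C).card : ℝ)
      = Real.exp (-(ρ * m / 2)) * ((signBall ρ C).card * Real.exp (ρ * m / 2)) := by
        rw [Real.exp_neg]; field_simp
    _ ≤ _ := mul_le_mul_of_nonneg_left this (Real.exp_pos _).le

/-- Members of the ball have positive inner product with `C`, so a vector and its negative are never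
both members. This covers small `m`, where the exponential bound is too weak. -/
theorem two_mul_card_signBall_le {m : ℕ} (hm : 0 < m) {ρ : ℝ} (hρ : 0 < ρ) (C : Fin m → ℝ) :
    2 * (signBall ρ C).card ≤ 2 ^ m := by
  have hpos : ∀ v ∈ signBall ρ C, 0 < ∑ j, (sign (v j) : ℝ) * C j := by
    intro v hv
    have h := le_inner_of_mem_signBall hv
    rw [Finset.sum_sub_distrib] at h
    have h2 : 0 ≤ ∑ j, C j ^ 2 / 2 := Finset.sum_nonneg fun j _ => by positivity
    have h3 : 0 < ρ * m / 2 := by positivity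
    linarith
  let neg : (Fin m → Bool) → (Fin m → Bool) := fun v j => !v j
  have hinj : Function.Injective neg := fun v w h => by
    funext j; simpa [neg] using congrFun h j
  have hdisj : Disjoint (signBall ρ C) ((signBall ρ C).image neg) := by
    rw [Finset.disjoint_left]
    intro v hv hv'
    obtain ⟨w, hw, rfl⟩ := Finset.mem_image.1 hv'
    have h1 := hpos _ hv
    have h2 := hpos _ hw
    simp only [neg, sign_not, Int.cast_neg, neg_mul, Finset.sum_neg_distrib] at h1
    linarith
  have h := Finset.card_le_univ ((signBall ρ C) ∪ (signBall ρ C).image neg)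
  rw [Finset.card_union_of_disjoint hdisj, Finset.card_image_of_injective _ hinj] at h
  simp at h
  omega

theorem card_signBall_le {m : ℕ} (hm : 0 < m) {ρ : ℝ} (hρ : 0 < ρ) (C : Fin m → ℝ) :
    ((signBall ρ C).card : ℝ) ≤ Real.exp (-(max (Real.log 2) (ρ * m / 2))) * 2 ^ m := by
  rcases max_cases (Real.log 2) (ρ * m / 2) with ⟨h, _⟩ | ⟨h, _⟩
  · rw [h, Real.exp_neg, Real.exp_log two_pos]
    have : (2 : ℝ) * (signBall ρ C).card ≤ 2 ^ m := by exact_mod_cast two_mul_card_signBall_le hm hρ C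
    linarith
  · rw [h]; exact card_signBall_le_exp ρ C

/-- A geometric sum in which every term is repeated `r` times. -/
theorem sum_range_pow_div_le {r : ℕ} (hr : 0 < r) {W : ℝ} (hW : 1 < W) (t : ℕ) :
    (W - 1) * ∑ s ∈ Finset.range (t + 1), W ^ (s / r) ≤ r * (W * W ^ (t / r)) := by
  have hfull : ∀ k, ∑ s ∈ Finset.range (r * k), W ^ (s / r) = r * ∑ i ∈ Finset.range k, W ^ i := by
    intro k
    induction k with
    | zero => simp
    | succ k ih =>
      rw [Nat.mul_succ, Finset.sum_range_add, ih, Finset.sum_range_succ, mul_add]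
      congr 1
      rw [Finset.sum_congr rfl (g := fun _ => W ^ k)]
      · simp
      · intro s hs
        rw [Nat.mul_add_div hr, Nat.div_eq_of_lt (Finset.mem_range.1 hs), add_zero]
  -- Complete the last, possibly partial, group of `r` equal terms.
  have hsub : Finset.range (t + 1) ⊆ Finset.range (r * (t / r + 1)) := by
    rw [Finset.range_subset_range]
    exact Nat.lt_mul_div_succ t hr
  calc _ ≤ (W - 1) * ∑ s ∈ Finset.range (r * (t / r + 1)), W ^ (s / r) := by
        refine mul_le_mul_of_nonneg_left
          (Finset.sum_le_sum_of_subset_of_nonneg hsub fun _ _ _ => by positivity) (by linarith)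
    _ = r * (W ^ (t / r + 1) - 1) := by
        rw [hfull, geom_sum_eq hW.ne']
        have : W - 1 ≠ 0 := by linarith
        field_simp
    _ ≤ _ := by
        refine mul_le_mul_of_nonneg_left ?_ (Nat.cast_nonneg r)
        rw [pow_succ']; linarith


/-! ### The hard streams and their queries -/

section Streams

variable {n c₁ c₂ S : ℕ}

/-- The stream that adds `D` to the left matrix, one entry of the list `l` after the other. -/
def writes (c₂ : ℕ) (D : Matrix (Fin n) (Fin c₁) ℤ) (l : List (Fin n × Fin c₁)) :
    List (Update n c₁ c₂) :=
  l.map fun p => .left p.1 p.2 (D p.1 p.2)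

/-- All positions in an `n × m` matrix. -/
noncomputable def cells (n m : ℕ) : List (Fin n × Fin m) := Finset.univ.toList

theorem sum_single_apply (D : Matrix (Fin n) (Fin c₁) ℤ) {l : List (Fin n × Fin c₁)}
    (hl : l.Nodup) (i : Fin n) (j : Fin c₁) :
    (l.map fun p => Matrix.single p.1 p.2 (D p.1 p.2)).sum i j =
      if (i, j) ∈ l then D i j else 0 := by
  induction l with
  | nil => simp
  | cons p l ih =>
    obtain ⟨hp, hl⟩ := List.nodup_cons.1 hl
    rw [List.map_cons, List.sum_cons, Matrix.add_apply, ih hl]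
    by_cases h : (i, j) = p
    · subst h; simp [hp]
    · rw [Matrix.single_apply_of_ne]
      · simp [h]
      · rintro ⟨h1, h2⟩; exact h (Prod.ext h1.symm h2.symm)

theorem foldl_writes (D Z : Matrix (Fin n) (Fin c₁) ℤ) (B : Matrix (Fin n) (Fin c₂) ℤ)
    (l : List (Fin n × Fin c₁)) :
    (writes c₂ D l).foldl Update.apply (Z, B) =
      (Z + (l.map fun p => Matrix.single p.1 p.2 (D p.1 p.2)).sum, B) := by
  induction l generalizing Z with
  | nil => simp [writes]
  | cons p l ih =>
    have := ih (Z + Matrix.single p.1 p.2 (D p.1 p.2))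
    rw [writes] at this ⊢
    rw [List.map_cons, List.foldl_cons, Update.apply, this, List.map_cons, List.sum_cons, add_assoc]

theorem foldl_writes_cells (D Z : Matrix (Fin n) (Fin c₁) ℤ) (B : Matrix (Fin n) (Fin c₂) ℤ) :
    (writes c₂ D (cells n c₁)).foldl Update.apply (Z, B) = (Z + D, B) := by
  rw [foldl_writes]
  congr 2
  ext i j
  rw [cells, sum_single_apply D (Finset.nodup_toList _)]
  simp

theorem foldl_writes_prefix (D Z : Matrix (Fin n) (Fin c₁) ℤ) (B : Matrix (Fin n) (Fin c₂) ℤ)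
    {v : List (Update n c₁ c₂)} (hv : v <+: writes c₂ D (cells n c₁)) :
    (v.foldl Update.apply (Z, B)).2 = B ∧ ∀ i j,
      (v.foldl Update.apply (Z, B)).1 i j = Z i j ∨
      (v.foldl Update.apply (Z, B)).1 i j = Z i j + D i j := by
  obtain ⟨l, hl, rfl⟩ := List.prefix_map_iff.1 hv
  have hn : l.Nodup := hl.sublist.nodup (Finset.nodup_toList _)
  have := foldl_writes D Z B l
  rw [writes] at this
  rw [this]
  refine ⟨rfl, fun i j => ?_⟩
  simp only [Matrix.add_apply, sum_single_apply D hn]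
  split_ifs <;> simp

theorem prefix_append_cases {α : Type*} {v l₁ l₂ : List α} (h : v <+: l₁ ++ l₂) :
    v <+: l₁ ∨ ∃ w, w <+: l₂ ∧ v = l₁ ++ w := by
  rcases List.prefix_or_prefix_of_prefix h (List.prefix_append l₁ l₂) with h' | ⟨w, rfl⟩
  · exact Or.inl h'
  · exact Or.inr ⟨w, (List.prefix_append_right_inj _).1 h, rfl⟩

/-- The rows of `A` after row `t`, the others being replaced by zero. -/
def rowsAfter (A : Matrix (Fin n) (Fin c₁) ℤ) (t : Fin n) : Matrix (Fin n) (Fin c₁) ℤ :=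
  fun i j => if t < i then A i j else 0

/-- The stream that deletes the rows of `A` after row `t` and writes a single `1` into the right
matrix, in row `t` and column `k`. -/
noncomputable def queryStream (A : Matrix (Fin n) (Fin c₁) ℤ) (t : Fin n) (k : Fin c₂) :
    List (Update n c₁ c₂) :=
  writes c₂ (-rowsAfter A t) (cells n c₁) ++ [.right t k 1]

theorem matrices_append_queryStream (A : Matrix (Fin n) (Fin c₁) ℤ) (t : Fin n) (k : Fin c₂) :
    matrices (writes c₂ A (cells n c₁) ++ queryStream A t k) =
      (A - rowsAfter A t, Matrix.single t k 1) := by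
  rw [matrices, queryStream, List.foldl_append, List.foldl_append, foldl_writes_cells,
    foldl_writes_cells]
  simp [Update.apply, sub_eq_add_neg]

theorem boundedBy_append_queryStream {M : ℝ} (hM : 1 ≤ M) {A : Matrix (Fin n) (Fin c₁) ℤ}
    (hA : ∀ i j, |(A i j : ℝ)| ≤ M) (t : Fin n) (k : Fin c₂) :
    BoundedBy M (writes c₂ A (cells n c₁) ++ queryStream A t k) := by
  have h0 : (0 : ℝ) ≤ M := zero_le_one.trans hM
  have hrow : ∀ i j, |((A i j + (-rowsAfter A t) i j : ℤ) : ℝ)| ≤ M := by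
    intro i j
    simp only [Matrix.neg_apply, rowsAfter]
    split_ifs
    · simpa using h0
    · simpa using hA i j
  intro v hv
  rcases prefix_append_cases hv with hv | ⟨w, hw, rfl⟩
  · obtain ⟨h2, h1⟩ := foldl_writes_prefix A 0 (0 : Matrix (Fin n) (Fin c₂) ℤ) hv
    refine ⟨fun i j => ?_, fun i j => ?_⟩
    · rw [matrices]
      rcases h1 i j with h | h <;> rw [h]
      · simpa using h0
      · simpa using hA i j
    · rw [matrices, h2]; simpa using h0
  · rcases prefix_append_cases hw with hw | ⟨w, hlast, rfl⟩
    · obtain ⟨h2, h1⟩ := foldl_writes_prefix (-rowsAfter A t) (0 + A)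
        (0 : Matrix (Fin n) (Fin c₂) ℤ) hw
      rw [matrices, List.foldl_append, foldl_writes_cells]
      refine ⟨fun i j => ?_, fun i j => ?_⟩
      · rcases h1 i j with h | h <;> rw [h]
        · simpa using hA i j
        · rw [zero_add]; exact hrow i j
      · rw [h2]; simpa using h0
    · rw [matrices, List.foldl_append, List.foldl_append, foldl_writes_cells, foldl_writes_cells,
        zero_add]
      rcases w with _ | ⟨a, w⟩
      · exact ⟨hrow, fun i j => by simpa using h0⟩
      · obtain ⟨rfl, hnil⟩ := List.cons_prefix_cons.1 hlast
        rw [List.prefix_nil.1 hnil]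
        refine ⟨hrow, fun i j => ?_⟩
        simp only [List.foldl_cons, List.foldl_nil, Update.apply, zero_add, Matrix.single_apply]
        split_ifs
        · simpa using hM
        · simpa using h0

theorem frobenius_norm_sq {a b : ℕ} (A : Matrix (Fin a) (Fin b) ℝ) :
    ‖A‖ ^ 2 = ∑ i, ∑ j, A i j ^ 2 := by
  rw [Matrix.frobenius_norm_def, ← Real.sqrt_eq_rpow, Real.sq_sqrt (by positivity)]
  simp

/-- Column `k` of the product is row `t` of `A`, and the right matrix has norm `1`; the error in the
other columns is discarded. -/
theorem sum_sq_sub_le_of_isApproxProduct {ε : ℝ} {A : Matrix (Fin n) (Fin c₁) ℤ} {t : Fin n}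
    {k : Fin c₂} {C : Matrix (Fin c₁) (Fin c₂) ℝ}
    (h : IsApproxProduct ε ((A - rowsAfter A t).map (fun z : ℤ => (z : ℝ)))
      ((Matrix.single t k 1 : Matrix (Fin n) (Fin c₂) ℤ).map (fun z : ℤ => (z : ℝ))) C) :
    ∑ j, ((A t j : ℝ) - C j k) ^ 2 ≤
      ε ^ 2 * ∑ i, if i ≤ t then ∑ j, (A i j : ℝ) ^ 2 else 0 := by
  have hB : (Matrix.single t k 1 : Matrix (Fin n) (Fin c₂) ℤ).map (fun z : ℤ => (z : ℝ)) =
      Matrix.single t k 1 := by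
    ext i j; simp [Matrix.single_apply]
  rw [IsApproxProduct, hB] at h
  have h2 := pow_le_pow_left₀ (norm_nonneg _) h 2
  rw [mul_pow, mul_pow, frobenius_norm_sq, frobenius_norm_sq, frobenius_norm_sq] at h2
  have hone : ∑ i, ∑ j, (Matrix.single t k (1 : ℝ) : Matrix (Fin n) (Fin c₂) ℝ) i j ^ 2 = 1 := by
    rw [Finset.sum_eq_single t, Finset.sum_eq_single k]
    · simp
    · intro j _ hj; simp [hj.symm]
    · simp
    · intro i _ hi; simp [hi.symm]
    · simp
  have hA : ∑ i, ∑ j, ((A - rowsAfter A t).map (fun z : ℤ => (z : ℝ))) i j ^ 2 =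
      ∑ i, if i ≤ t then ∑ j, (A i j : ℝ) ^ 2 else 0 := by
    refine Finset.sum_congr rfl fun i _ => ?_
    split_ifs with hi
    · simp [rowsAfter, not_lt.2 hi]
    · simp [rowsAfter, not_le.1 hi]
  rw [hone, mul_one, hA] at h2
  refine le_trans (Finset.sum_le_sum fun j _ => ?_) h2
  refine le_trans (le_of_eq ?_) (Finset.single_le_sum (f := fun k => _) (fun k _ => sq_nonneg _)
    (Finset.mem_univ k))
  simp [rowsAfter]

end Streams

/-! ### Measurability and the symmetry between the two matrices -/

section Algorithms

variable {n c₁ c₂ S : ℕ} {Ω : Type*} [MeasurableSpace Ω]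

theorem Algorithm.measurable_memory (alg : Algorithm Ω n c₁ c₂ S) (u : List (Update n c₁ c₂)) :
    Measurable fun ω => alg.memory ω u := by
  have key : ∀ (l : List (Update n c₁ c₂ × ℕ)) (f : Ω → Fin S → Bool), Measurable f →
      Measurable fun ω => l.foldl (fun s x => alg.step ω x.2 s x.1) (f ω) := by
    intro l
    induction l with
    | nil => intro f hf; exact hf
    | cons x l ih =>
      intro f hf
      refine ih _ ?_
      have h : Measurable fun p : Ω × (Fin S → Bool) => alg.step p.1 x.2 p.2 x.1 :=
        measurable_from_prod_countable_left fun s => alg.measurable_step _ _ _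
      exact h.comp (measurable_id.prodMk hf)
  exact key _ _ alg.measurable_init

theorem Algorithm.measurableSet_isApproxProduct (alg : Algorithm Ω n c₁ c₂ S) (ε : ℝ)
    (A : Matrix (Fin n) (Fin c₁) ℝ) (B : Matrix (Fin n) (Fin c₂) ℝ) (u : List (Update n c₁ c₂)) :
    MeasurableSet {ω | IsApproxProduct ε A B (alg.run ω u)} := by
  have hrun : ∀ i j, Measurable fun ω => alg.run ω u i j := by
    intro i j
    have h : Measurable fun p : Ω × (Fin S → Bool) => alg.output p.1 p.2 i j :=
      measurable_from_prod_countable_left fun s => alg.measurable_output _ _ _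
    exact h.comp (measurable_id.prodMk (alg.measurable_memory u))
  have hnorm : Measurable fun ω => ‖A.transpose * B - alg.run ω u‖ := by
    simp only [Matrix.frobenius_norm_def, Matrix.sub_apply]
    fun_prop
  exact measurableSet_le hnorm measurable_const

/-- The update with the roles of the two matrices exchanged. -/
def Update.swap : Update n c₁ c₂ → Update n c₂ c₁
  | .left i j δ => .right i j δ
  | .right i j δ => .left i j δ

/-- The algorithm with the roles of the two matrices exchanged. -/
def Algorithm.swap (alg : Algorithm Ω n c₁ c₂ S) : Algorithm Ω n c₂ c₁ S where
  init := alg.init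
  step ω t s x := alg.step ω t s x.swap
  output ω s := (alg.output ω s).transpose
  measurable_init := alg.measurable_init
  measurable_step t s x := alg.measurable_step t s x.swap
  measurable_output s i j := alg.measurable_output s j i

theorem matrices_map_swap (u : List (Update n c₁ c₂)) :
    matrices (u.map Update.swap) = (matrices u).swap := by
  have key : ∀ p, (u.map Update.swap).foldl Update.apply (Prod.swap p) =
      (u.foldl Update.apply p).swap := by
    induction u with
    | nil => intro p; rfl
    | cons x u ih =>
      intro p
      rw [List.map_cons, List.foldl_cons, List.foldl_cons, ← ih]
      cases x <;> rfl
  exact key (0, 0)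

theorem BoundedBy.map_swap {M : ℝ} {u : List (Update n c₁ c₂)} (hu : BoundedBy M u) :
    BoundedBy M (u.map Update.swap) := by
  intro v hv
  obtain ⟨w, hw, rfl⟩ := List.prefix_map_iff.1 hv
  rw [matrices_map_swap]
  exact (hu w hw).symm

theorem Algorithm.swap_run (alg : Algorithm Ω n c₁ c₂ S) (ω : Ω) (u : List (Update n c₂ c₁)) :
    alg.swap.run ω u = (alg.run ω (u.map Update.swap)).transpose := by
  simp only [Algorithm.run, Algorithm.memory, Algorithm.swap, List.zipIdx_map, List.foldl_map,
    Prod.map_fst, Prod.map_snd, id]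

/-- Transposition turns `Aᵀ * B` into `Bᵀ * A` and preserves the Frobenius norm. -/
theorem Algorithm.Solves.swap {alg : Algorithm Ω n c₁ c₂ S} {P : Measure Ω} {ε M p : ℝ}
    (h : alg.Solves P ε M p) : alg.swap.Solves P ε M p := by
  intro u hu
  convert h (u.map Update.swap) hu.map_swap using 4 with ω
  rw [Algorithm.swap_run, matrices_map_swap, IsApproxProduct, IsApproxProduct,
    ← Matrix.frobenius_norm_transpose, Matrix.transpose_sub, Matrix.transpose_mul,
    Matrix.transpose_transpose, Matrix.transpose_transpose]
  simp only [Prod.fst_swap, Prod.snd_swap, mul_right_comm]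

end Algorithms

/-! ### From an algorithm to a list decoder -/

section LowerBound

variable {n m c₂ S N : ℕ}

/-- The matrix whose row `i < N` is the sign vector `x i` scaled by `K ^ (i / r)`; the remaining
rows are zero. -/
def signMatrix (n K r : ℕ) (x : Fin N → Fin m → Bool) : Matrix (Fin n) (Fin m) ℤ :=
  fun i j => if h : (i : ℕ) < N then (K : ℤ) ^ ((i : ℕ) / r) * sign (x ⟨i, h⟩ j) else 0

theorem abs_signMatrix_le {K r : ℕ} {M : ℝ} (hM : 1 ≤ M)
    (hK : ∀ t < N, (K : ℝ) ^ (t / r) ≤ M) (x : Fin N → Fin m → Bool) (i : Fin n) (j : Fin m) :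
    |(signMatrix n K r x i j : ℝ)| ≤ M := by
  rw [signMatrix]
  split_ifs with h
  · rw [← Int.cast_abs, abs_mul, abs_sign, mul_one, abs_of_nonneg (by positivity)]
    push_cast
    exact hK _ h
  · simpa using zero_le_one.trans hM

theorem rowsAfter_signMatrix_congr {K r : ℕ} {x y : Fin N → Fin m → Bool} {t : Fin N} (hN : N ≤ n)
    (h : ∀ u, t < u → x u = y u) :
    rowsAfter (signMatrix n K r x) (t.castLE hN) = rowsAfter (signMatrix n K r y) (t.castLE hN) := by
  funext i j
  simp only [rowsAfter, signMatrix]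
  split_ifs with h1 h2
  · rw [h ⟨i, h2⟩ h1]
  · rfl
  · rfl

/-- Rows up to `t` have squared norms summing to at most `r * m * K ^ 2 / (K ^ 2 - 1)` times the
squared scale of row `t`; `hε` is what makes this small enough for a ball of positive `ρ`. -/
theorem mul_sum_sq_signMatrix_le {K r : ℕ} (hK : 2 ≤ K) (hr : 0 < r) {ρ ε : ℝ}
    (hε : ε ^ 2 * r * (K : ℝ) ^ 2 ≤ (1 - ρ) * ((K : ℝ) ^ 2 - 1)) (x : Fin N → Fin m → Bool)
    (t : Fin n) :
    ε ^ 2 * ∑ i, (if i ≤ t then ∑ j, (signMatrix n K r x i j : ℝ) ^ 2 else 0) ≤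
      (1 - ρ) * m * ((K : ℝ) ^ ((t : ℕ) / r)) ^ 2 := by
  set W : ℝ := (K : ℝ) ^ 2 with hW
  have hK' : (2 : ℝ) ≤ K := by exact_mod_cast hK
  have hW1 : 1 < W := by rw [hW]; nlinarith
  have hle : ∑ i, (if i ≤ t then ∑ j, (signMatrix n K r x i j : ℝ) ^ 2 else 0) ≤
      m * ∑ s ∈ Finset.range ((t : ℕ) + 1), W ^ (s / r) := by
    calc _ ≤ ∑ i : Fin n, (if (i : ℕ) ∈ Finset.range ((t : ℕ) + 1) then m * W ^ ((i : ℕ) / r)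
          else 0) := by
          refine Finset.sum_le_sum fun i _ => ?_
          have hiff : i ≤ t ↔ (i : ℕ) ∈ Finset.range ((t : ℕ) + 1) := by
            rw [Finset.mem_range, Nat.lt_succ_iff]; rfl
          simp only [hiff]
          split_ifs
          · calc _ ≤ ∑ _j : Fin m, W ^ ((i : ℕ) / r) := by
                  refine Finset.sum_le_sum fun j _ => ?_
                  rw [signMatrix]
                  split_ifs
                  · push_cast
                    rw [mul_pow, sign_sq, mul_one, hW, ← pow_mul, ← pow_mul, mul_comm]
                  · simp only [Int.cast_zero, ne_eq, OfNat.ofNat_ne_zero, not_false_eq_true,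
                      zero_pow]
                    positivity
              _ = _ := by simp
          · exact le_rfl
      _ = ∑ s ∈ Finset.range n, (if s ∈ Finset.range ((t : ℕ) + 1) then m * W ^ (s / r) else 0) :=
          Fin.sum_univ_eq_sum_range
            (fun s => if s ∈ Finset.range ((t : ℕ) + 1) then m * W ^ (s / r) else 0) n
      _ ≤ _ := by
          rw [Finset.sum_ite_mem, Finset.mul_sum]
          exact Finset.sum_le_sum_of_subset_of_nonneg Finset.inter_subset_right
            fun _ _ _ => by positivity
  have hgeom := sum_range_pow_div_le hr hW1 t
  set G := ∑ s ∈ Finset.range ((t : ℕ) + 1), W ^ (s / r) with hG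
  have hpow : ((K : ℝ) ^ ((t : ℕ) / r)) ^ 2 = W ^ ((t : ℕ) / r) := by
    rw [hW, ← pow_mul, ← pow_mul, mul_comm]
  rw [hpow]
  set V := W ^ ((t : ℕ) / r) with hV
  have hV0 : 0 < V := by positivity
  have hkey : (W - 1) * (ε ^ 2 * G) ≤ (W - 1) * ((1 - ρ) * V) := by
    calc (W - 1) * (ε ^ 2 * G) = ε ^ 2 * ((W - 1) * G) := by ring
      _ ≤ ε ^ 2 * (r * (W * V)) := mul_le_mul_of_nonneg_left hgeom (sq_nonneg _)
      _ = (ε ^ 2 * r * W) * V := by ring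
      _ ≤ ((1 - ρ) * (W - 1)) * V := mul_le_mul_of_nonneg_right hε hV0.le
      _ = _ := by ring
  have hkey' := le_of_mul_le_mul_left hkey (by linarith)
  calc _ ≤ ε ^ 2 * (m * G) := mul_le_mul_of_nonneg_left hle (sq_nonneg _)
    _ = m * (ε ^ 2 * G) := by ring
    _ ≤ m * ((1 - ρ) * V) := mul_le_mul_of_nonneg_left hkey' (Nat.cast_nonneg m)
    _ = _ := by ring

variable {Ω : Type*} [MeasurableSpace Ω]

/-- The sign vectors compatible with the output of the algorithm when it is run from the memory `s`
on the stream that queries row `t`. -/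
noncomputable def decode (alg : Algorithm Ω n m c₂ S) (ω : Ω) (K r : ℕ) (ρ : ℝ) (hN : N ≤ n)
    (k : Fin c₂) (s : Fin S → Bool) (t : Fin N) (x : Fin N → Fin m → Bool) :
    Finset (Fin m → Bool) :=
  signBall ρ fun j =>
    alg.output ω (((queryStream (signMatrix n K r x) (t.castLE hN) k).zipIdx
      (cells n m).length).foldl (fun s x => alg.step ω x.2 s x.1) s) j k / (K : ℝ) ^ ((t : ℕ) / r)

theorem Algorithm.memory_append (alg : Algorithm Ω n m c₂ S) (ω : Ω)
    (u v : List (Update n m c₂)) :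
    alg.memory ω (u ++ v) =
      (v.zipIdx u.length).foldl (fun s x => alg.step ω x.2 s x.1) (alg.memory ω u) := by
  rw [Algorithm.memory, List.zipIdx_append, List.foldl_append, zero_add, Algorithm.memory]

theorem mem_decode {alg : Algorithm Ω n m c₂ S} {ω : Ω} {K r : ℕ} (hK : 2 ≤ K) (hr : 0 < r)
    {ρ ε : ℝ} (hε : ε ^ 2 * r * (K : ℝ) ^ 2 ≤ (1 - ρ) * ((K : ℝ) ^ 2 - 1)) (hN : N ≤ n)
    {k : Fin c₂} {x : Fin N → Fin m → Bool} {t : Fin N}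
    (h : IsApproxProduct ε
      ((signMatrix n K r x - rowsAfter (signMatrix n K r x) (t.castLE hN)).map
        (fun z : ℤ => (z : ℝ)))
      ((Matrix.single (t.castLE hN) k 1 : Matrix (Fin n) (Fin c₂) ℤ).map (fun z : ℤ => (z : ℝ)))
      (alg.run ω (writes c₂ (signMatrix n K r x) (cells n m) ++
        queryStream (signMatrix n K r x) (t.castLE hN) k))) :
    x t ∈ decode alg ω K r ρ hN k
      (alg.memory ω (writes c₂ (signMatrix n K r x) (cells n m))) t x := by
  have h1 := (sum_sq_sub_le_of_isApproxProduct h).trans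
    (mul_sum_sq_signMatrix_le hK hr hε x (t.castLE hN))
  rw [decode, signBall, Finset.mem_filter]
  refine ⟨Finset.mem_univ _, ?_⟩
  have hK0 : (0 : ℝ) < K := by exact_mod_cast (by omega : 0 < K)
  -- The clock at which the query starts is the same for all `x`, so the decoder knows it.
  have hlen : (writes c₂ (signMatrix n K r x) (cells n m)).length = (cells n m).length := by
    simp [writes]
  rw [Algorithm.run, Algorithm.memory_append, hlen] at h1
  set s := List.foldl (fun s x => alg.step ω x.2 s x.1)
    (alg.memory ω (writes c₂ (signMatrix n K r x) (cells n m)))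
    ((queryStream (signMatrix n K r x) (t.castLE hN) k).zipIdx (cells n m).length) with hs
  rw [Fin.val_castLE] at h1
  set q : ℝ := (K : ℝ) ^ ((t : ℕ) / r) with hq
  have hq0 : 0 < q := by positivity
  have hterm : ∀ j, ((signMatrix n K r x (t.castLE hN) j : ℝ) - alg.output ω s j k) ^ 2 =
      q ^ 2 * ((sign (x t j) : ℝ) - alg.output ω s j k / q) ^ 2 := by
    intro j
    have : (signMatrix n K r x (t.castLE hN) j : ℝ) = q * sign (x t j) := by
      rw [signMatrix, dif_pos (by exact t.2)]
      push_cast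
      rfl
    rw [this, ← mul_pow, mul_sub, mul_div_cancel₀ _ hq0.ne']
  simp only [hterm, ← Finset.mul_sum] at h1
  rw [mul_comm ((1 - ρ) * m)] at h1
  exact le_of_mul_le_mul_left h1 (by positivity)

/-- The lower bound for the hard instance with `N` rows of signs, in groups of `r` rows of equal
scale. -/
theorem mul_max_le_of_solves {P : Measure Ω} [IsProbabilityMeasure P]
    {alg : Algorithm Ω n m c₂ S} {ε M : ℝ} (halg : alg.Solves P ε M (4 / 5)) (hM : 1 ≤ M)
    (hm : 0 < m) (k : Fin c₂) {K r : ℕ} (hK : 2 ≤ K) (hr : 0 < r) {ρ : ℝ} (hρ : 0 < ρ)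
    (hε : ε ^ 2 * r * (K : ℝ) ^ 2 ≤ (1 - ρ) * ((K : ℝ) ^ 2 - 1)) (hN : N ≤ n)
    (hKM : ∀ t < N, (K : ℝ) ^ (t / r) ≤ M) :
    N * max (Real.log 2) (ρ * m / 2) ≤ 5 * (S * Real.log 2) := by
  let E : (Fin N → Fin m → Bool) × Fin N → Set Ω := fun p => {ω | IsApproxProduct ε
      ((signMatrix n K r p.1 - rowsAfter (signMatrix n K r p.1) (p.2.castLE hN)).map
        (fun z : ℤ => (z : ℝ)))
      ((Matrix.single (p.2.castLE hN) k 1 : Matrix (Fin n) (Fin c₂) ℤ).map (fun z : ℤ => (z : ℝ)))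
      (alg.run ω (writes c₂ (signMatrix n K r p.1) (cells n m) ++
        queryStream (signMatrix n K r p.1) (p.2.castLE hN) k))}
  obtain ⟨ω, hω⟩ := exists_mul_card_le_card_filter (p := 4 / 5) P E
    (fun p => alg.measurableSet_isApproxProduct _ _ _ _) fun p => by
      have := halg _ (boundedBy_append_queryStream hM
        (fun i j => abs_signMatrix_le (n := n) hM hKM p.1 i j) (p.2.castLE hN) k)
      rwa [matrices_append_queryStream] at this
  -- The message is the memory after the matrix is written; the query uses only rows after `t`, as
  -- augmented indexing allows.
  have key := mul_le_five_mul_log_card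
    (fun x : Fin N → Fin m → Bool => alg.memory ω (writes c₂ (signMatrix n K r x) (cells n m)))
    (decode alg ω K r ρ hN k) ?_ (le_max_left (Real.log 2) (ρ * m / 2)) ?_ ?_
  · simpa [Real.log_pow] using key
  · intro s t x y hxy
    rw [decode, decode, queryStream, queryStream, rowsAfter_signMatrix_congr hN hxy]
  · intro s t x
    refine (card_signBall_le hm hρ _).trans (le_of_eq ?_)
    simp
  · rw [Fintype.card_prod, Fintype.card_fun, Fintype.card_fin, Nat.cast_mul, Nat.cast_pow] at hω
    refine hω.trans ?_
    rw [Fintype.sum_prod_type]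
    refine Finset.sum_le_sum fun x _ => ?_
    rw [Finset.card_filter]
    push_cast
    refine Finset.sum_le_sum fun t _ => ?_
    by_cases h1 : ω ∈ E (x, t)
    · rw [Set.indicator_of_mem h1, if_pos (mem_decode hK hr hε hN h1)]
    · rw [Set.indicator_of_notMem h1]
      split_ifs <;> norm_num

end LowerBound

/-! ### Choice of the parameters -/

section Parameters

/-- The lower bound in terms of the number of columns of the left matrix. -/
theorem exists_mul_le_of_solves {γ ε₀ : ℝ} (hγ : 0 < γ) (h0 : 0 < ε₀) (h1 : ε₀ < 1) :
    ∃ κ : ℝ, 0 < κ ∧ ∀ (n m c₂ S : ℕ) (ε R : ℝ), 0 < m → 0 < c₂ → 0 < ε → ε ≤ ε₀ → 2 ≤ R →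
      4 * Real.logb 10 R / ε ^ 2 ≤ n →
      ∀ (Ω : Type*) [MeasurableSpace Ω] (P : Measure Ω) [IsProbabilityMeasure P]
        (alg : Algorithm Ω n m c₂ S), alg.Solves P ε (R ^ γ) (4 / 5) →
        κ * (m * (ε ^ 2)⁻¹ * Real.log R) ≤ S := by
  set η : ℝ := 1 - ε₀ ^ 2 with hη
  have hη0 : 0 < η := by rw [hη]; nlinarith
  obtain ⟨K₀, hK₀⟩ := exists_nat_gt (2 / η)
  set K : ℕ := K₀ + 2 with hKdef
  have hK : 2 ≤ K := by omega
  have hK1 : (1 : ℝ) < K := by exact_mod_cast hK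
  -- `K` is so large that the geometric tail costs only half of the slack `η`, leaving `ρ = η / 2`.
  have hKη : 2 < η * (K : ℝ) ^ 2 := by
    have h2 : 2 / η < K := hK₀.trans (by rw [hKdef]; push_cast; linarith)
    have h3 : 2 < η * K := by rwa [div_lt_iff₀' hη0] at h2
    nlinarith
  have hlogK : 0 < Real.log K := Real.log_pos hK1
  have hlog10 : 0 < Real.log 10 := Real.log_pos (by norm_num)
  have hlog2 : 0 < Real.log 2 := Real.log_pos one_lt_two
  set a : ℝ := min (γ / Real.log K) (2 / Real.log 10) with ha
  have ha0 : 0 < a := by rw [ha]; positivity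
  refine ⟨(ε₀ ^ 2 / 2 * a * (η / 4)) / (5 * Real.log 2), by positivity, ?_⟩
  intro n m c₂ S ε R hm hc₂ hε hεle hR hn Ω _ P _ alg halg
  have hR0 : 0 < R := by linarith
  have hL2 : Real.log 2 ≤ Real.log R := Real.log_le_log two_pos hR
  set ℓ := Real.log R with hℓ
  have hℓ0 : 0 < ℓ := hlog2.trans_le hL2
  have hM : 1 ≤ R ^ γ := Real.one_le_rpow (by linarith) hγ.le
  have hε2 : 0 < ε ^ 2 := by positivity
  have hratio : 1 ≤ ε₀ ^ 2 / ε ^ 2 := by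
    rw [one_le_div hε2]; exact pow_le_pow_left₀ hε.le hεle 2
  set r : ℕ := ⌊ε₀ ^ 2 / ε ^ 2⌋₊ with hr
  have hr1 : 1 ≤ r := Nat.one_le_floor_iff _ |>.2 hratio
  have hrle : (r : ℝ) ≤ ε₀ ^ 2 / ε ^ 2 := Nat.floor_le (by positivity)
  have hrge : ε₀ ^ 2 / 2 * (ε ^ 2)⁻¹ ≤ r := by
    have h2 := Nat.lt_floor_add_one (ε₀ ^ 2 / ε ^ 2)
    rw [← hr] at h2
    have h3 : (1 : ℝ) ≤ r := by exact_mod_cast hr1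
    have h4 : ε₀ ^ 2 / 2 * (ε ^ 2)⁻¹ = (ε₀ ^ 2 / ε ^ 2) / 2 := by ring
    rw [h4]; linarith
  have hrε : ε ^ 2 * r ≤ 1 - η := by
    rw [le_div_iff₀ hε2] at hrle
    rw [hη]; linarith
  set b : ℝ := 4 * Real.logb 10 R with hb
  have hbℓ : b = 4 / Real.log 10 * ℓ := by rw [hb, Real.logb]; ring
  -- The constant `4` enters here: `R ≥ 2` and `10 ≤ 2 ^ 4`. Hence rounding `b` down loses at most a
  -- factor `2`.
  have hb1 : 1 ≤ b := by
    have h2 : Real.log 10 ≤ 4 * Real.log 2 := by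
      rw [show (4 : ℝ) * Real.log 2 = Real.log (2 ^ 4) by rw [Real.log_pow]; norm_num]
      exact Real.log_le_log (by norm_num) (by norm_num)
    rw [hbℓ, div_mul_eq_mul_div, le_div_iff₀ hlog10]
    linarith
  -- The scales are `K ^ 0, …, K ^ (T - 1)`, hence the `+ 1`. The first bound keeps entries below `R
  -- ^ γ`, the second makes `r * T` rows fit into `n`.
  set T : ℕ := min (⌊γ * ℓ / Real.log K⌋₊ + 1) ⌊b⌋₊ with hT
  have hTge : a * ℓ ≤ T := by
    rw [hT, Nat.cast_min, le_min_iff]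
    constructor
    · calc a * ℓ ≤ γ / Real.log K * ℓ := mul_le_mul_of_nonneg_right (min_le_left _ _) hℓ0.le
        _ = γ * ℓ / Real.log K := by ring
        _ ≤ _ := by push_cast; exact (Nat.lt_floor_add_one _).le
    · have h2 := Nat.lt_floor_add_one b
      have h3 : (1 : ℝ) ≤ (⌊b⌋₊ : ℝ) := by exact_mod_cast (Nat.one_le_floor_iff _).2 hb1
      calc a * ℓ ≤ 2 / Real.log 10 * ℓ := mul_le_mul_of_nonneg_right (min_le_right _ _) hℓ0.le
        _ = b / 2 := by rw [hbℓ]; ring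
        _ ≤ _ := by linarith
  have hTb : (T : ℝ) ≤ b := by
    calc (T : ℝ) ≤ (⌊b⌋₊ : ℝ) := by exact_mod_cast min_le_right _ _
      _ ≤ b := Nat.floor_le (by linarith)
  have hN : r * T ≤ n := by
    have : ((r * T : ℕ) : ℝ) ≤ n := by
      push_cast
      calc (r : ℝ) * T ≤ (1 / ε ^ 2) * b := by
            refine mul_le_mul (hrle.trans ?_) hTb (Nat.cast_nonneg _) (by positivity)
            exact div_le_div_of_nonneg_right (by nlinarith) hε2.le
        _ = b / ε ^ 2 := by ring
        _ ≤ n := hn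
    exact_mod_cast this
  have hKM : ∀ t < r * T, (K : ℝ) ^ (t / r) ≤ R ^ γ := by
    intro t ht
    have h2 : t / r < T := Nat.div_lt_of_lt_mul ht
    have h3 : t / r ≤ ⌊γ * ℓ / Real.log K⌋₊ :=
      Nat.lt_succ_iff.1 (h2.trans_le (min_le_left _ _))
    have h4 : ((t / r : ℕ) : ℝ) ≤ γ * ℓ / Real.log K :=
      (Nat.cast_le.2 h3).trans (Nat.floor_le (by positivity))
    rw [le_div_iff₀ hlogK] at h4
    rw [← Real.log_le_log_iff (by positivity) (by positivity), Real.log_pow, Real.log_rpow hR0]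
    exact h4
  have hεK : ε ^ 2 * r * (K : ℝ) ^ 2 ≤ (1 - η / 2) * ((K : ℝ) ^ 2 - 1) := by
    calc ε ^ 2 * r * (K : ℝ) ^ 2 ≤ (1 - η) * (K : ℝ) ^ 2 :=
          mul_le_mul_of_nonneg_right hrε (by positivity)
      _ ≤ _ := by nlinarith
  have key := mul_max_le_of_solves halg hM hm ⟨0, hc₂⟩ hK hr1 (half_pos hη0) hεK hN hKM
  have hmax := le_max_right (Real.log 2) (η / 2 * m / 2)
  rw [div_mul_eq_mul_div, div_le_iff₀ (by positivity)]
  calc ε₀ ^ 2 / 2 * a * (η / 4) * (m * (ε ^ 2)⁻¹ * ℓ)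
      = (ε₀ ^ 2 / 2 * (ε ^ 2)⁻¹) * (a * ℓ) * (η / 2 * m / 2) := by ring
    _ ≤ r * T * (η / 2 * m / 2) := by gcongr
    _ ≤ ((r * T : ℕ) : ℝ) * max (Real.log 2) (η / 2 * m / 2) := by
        push_cast
        exact mul_le_mul_of_nonneg_left hmax (by positivity)
    _ ≤ 5 * (S * Real.log 2) := key
    _ = S * (5 * Real.log 2) := by ring

end Parameters

end MatrixProductStream

theorem mainTheorem12 :
    ∃ β : ℝ, 0 < β ∧ ∀ γ : ℝ, 0 < γ → ∀ ε₀ : ℝ, ε₀ < 1 → ∃ κ : ℝ, 0 < κ ∧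
      ∀ (n c₁ c₂ c : ℕ) (ε : ℝ), 1 ≤ n → 1 ≤ c₁ → 1 ≤ c₂ → c = c₁ + c₂ → 0 < ε → ε ≤ ε₀ →
        β * Real.logb 10 ((c : ℝ) * n) / ε ^ 2 ≤ n →
        ∀ (Ω : Type*) [MeasurableSpace Ω] (P : Measure Ω) [IsProbabilityMeasure P] (S : ℕ)
          (alg : MatrixProductStream.Algorithm Ω n c₁ c₂ S),
          alg.Solves P ε (((n : ℝ) * c) ^ γ) (4 / 5) →
          κ * (c * (ε ^ 2)⁻¹ * Real.log ((n : ℝ) * c)) ≤ S := by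
  refine ⟨4, by norm_num, fun γ hγ ε₀ hε₀ => ?_⟩
  rcases le_or_gt ε₀ 0 with hneg | hpos
  · exact ⟨1, one_pos, fun n c₁ c₂ c ε _ _ _ _ h1 h2 => absurd (h1.trans_le h2) (not_lt.2 hneg)⟩
  obtain ⟨κ, hκ, H⟩ := MatrixProductStream.exists_mul_le_of_solves hγ hpos hε₀
  refine ⟨κ / 2, by positivity, ?_⟩
  intro n c₁ c₂ c ε hn hc₁ hc₂ hc hε hεle hlarge Ω _ P _ S alg halg
  have hR : (2 : ℝ) ≤ (n : ℝ) * c := by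
    have : 2 ≤ n * c := by nlinarith
    exact_mod_cast this
  rw [mul_comm (c : ℝ)] at hlarge
  have hD : 0 ≤ (ε ^ 2)⁻¹ * Real.log ((n : ℝ) * c) :=
    mul_nonneg (by positivity) (Real.log_nonneg (by linarith))
  have reduce : ∀ m : ℕ, c ≤ 2 * m → κ * (m * (ε ^ 2)⁻¹ * Real.log ((n : ℝ) * c)) ≤ S →
      κ / 2 * (c * (ε ^ 2)⁻¹ * Real.log ((n : ℝ) * c)) ≤ S := by
    intro m hm h
    refine le_trans ?_ h
    have hm' : (c : ℝ) ≤ 2 * m := by exact_mod_cast hm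
    have := mul_le_mul_of_nonneg_left (mul_le_mul_of_nonneg_right hm' hD) hκ.le
    linarith
  -- The matrix with more columns, at least `c / 2`, carries the signs.
  rcases le_total c₂ c₁ with h | h
  · exact reduce c₁ (by omega) (H n c₁ c₂ S ε _ hc₁ hc₂ hε hεle hR hlarge Ω P alg halg)
  · exact reduce c₂ (by omega) (H n c₂ c₁ S ε _ hc₂ hc₁ hε hεle hR hlarge Ω P alg.swap halg.swap)
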